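/- Let $A$ be a left hereditary ring (every left ideal of $A$ is projective) and let $A\text{-Mod}$ be the category of all left $A$-modules; subcategories are full and closed under isomorphisms. For a class $\mathcal{C}$ of modules put $\mathcal{C}^{\perp_0}=\{N \mid \operatorname{Hom}_A(C,N)=0 \text{ for all } C\in\mathcal{C}\}$ and ${}^{\perp_0}\mathcal{C}=\{M \mid \operatorname{Hom}_A(M,C)=0 \text{ for all } C\in\mathcal{C}\}$. A torsion pair in $A\text{-Mod}$ is a pair $(\mathcal{T},\mathcal{F})$ of subcategories such that $\operatorname{Hom}_A(T,F)=0$ for all $T\in\mathcal{T}$, $F\in\mathcal{F}$, and every module $M$ admits a short exact sequence $0\to T\to M\to F\to 0$ with $T\in\mathcal{T}$ and $F\in\mathcal{F}$. Put $$\alpha(\mathcal{T})=\{X\in\mathcal{T} \mid \ker f\in\mathcal{T} \text{ for all } T\in\mathcal{T} \text{ and all } f\colon T\to X\},$$ $$\beta(\mathcal{F})=\{Y\in\mathcal{F} \mid \operatorname{coker} f\in\mathcal{F} \text{ for all } F\in\mathcal{F} \text{ and all } f\colon Y\to F\}.$$ A pair $(\mathcal{X},\mathcal{Y})$ of subcategories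 is a complete Ext-orthogonal pair if - $M\in\mathcal{X}$ if and only if $\operatorname{Ext}^n_A(M,Y)=0$ for all $n\ge 0$ and all $Y\in\mathcal{Y}$; - $N\in\mathcal{Y}$ if and only if $\operatorname{Ext}^n_A(X,N)=0$ for all $n\ge 0$ and all $X\in\mathcal{X}$; - every module $M$ admits an exact sequence $0\to Y_M\to X_M\to M\to Y^M\to X^M\to 0$ with $X_M,X^M\in\mathcal{X}$ and $Y_M,Y^M\in\mathcal{Y}$. Proposition. Let $(\mathcal{X},\mathcal{Y})$ be a complete Ext-orthogonal pair in $A\text{-Mod}$. Then there is exactly one torsion pair $(\mathcal{T},\mathcal{F})$ in $A\text{-Mod}$ such that $\mathcal{X}=\alpha(\mathcal{T})$ and $\mathcal{Y}=\beta(\mathcal{F})$. It is the torsion pair $({}^{\perp_0}(\mathcal{X}^{\perp_0}),\,\mathcal{X}^{\perp_0})$ generated by $\mathcal{X}$. -/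

import Mathlib

open CategoryTheory

universe w v u

namespace TorsionExt

section Abelian

variable {C : Type u} [Category.{v} C] [Abelian C]

/-- A torsion pair `(𝒯, ℱ)` in an abelian category. As usual, subcategories are full and closed
under isomorphisms. -/
structure IsTorsionPair (T F : ObjectProperty C) : Prop where
  left_iso : T.IsClosedUnderIsomorphisms
  right_iso : F.IsClosedUnderIsomorphisms
  /-- There are no non-zero morphisms from `𝒯` to `ℱ`. -/
  hom_eq_zero : ∀ ⦃X Y : C⦄ (f : X ⟶ Y), T X → F Y → f = 0
  /-- Every `M` sits in a short exact sequence `0 → X → M → Y → 0`, `X ∈ 𝒯`, `Y ∈ ℱ`. -/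
  exists_shortExact : ∀ M : C, ∃ (X Y : C) (i : X ⟶ M) (p : M ⟶ Y) (zero : i ≫ p = 0),
    T X ∧ F Y ∧ (ShortComplex.mk i p zero).ShortExact

/-- The class of objects `X` such that the kernel of every morphism `T ⟶ X` with `T ∈ 𝒯`
lies in `𝒯`. -/
def kernelClass (T : ObjectProperty C) : ObjectProperty C :=
  fun X ↦ ∀ ⦃Z : C⦄ (f : Z ⟶ X), T Z → T (Limits.kernel f)

/-- The class of objects `X` such that the cokernel of every morphism `X ⟶ F` with `F ∈ ℱ`
lies in `ℱ`. -/
def cokernelClass (F : ObjectProperty C) : ObjectProperty C :=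
  fun X ↦ ∀ ⦃Z : C⦄ (f : X ⟶ Z), F Z → F (Limits.cokernel f)

/-- `α(𝒯)`. -/
def alpha (T : ObjectProperty C) : ObjectProperty C := T ⊓ kernelClass T

/-- `β(ℱ)`. -/
def beta (F : ObjectProperty C) : ObjectProperty C := F ⊓ cokernelClass F

/-- The torsion class `𝐓(𝒳) = ^{⊥₀}(𝒳^{⊥₀})` generated by `𝒳`. The torsion pair generated
by `𝒳` is `(𝐓(𝒳), 𝒳^{⊥₀})`. -/
def torsionClass (X : ObjectProperty C) : ObjectProperty C :=
  X.rightOrthogonal.leftOrthogonal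

/-- Ext-orthogonal pairs: each class is the `Ext^n`-orthogonal, in all degrees `n ≥ 0`, of the
other one (`Ext^n` is zero for negative `n`, and `Ext^0` is `Hom`). -/
structure IsExtOrthogonalPair [HasExt.{w} C] (X Y : ObjectProperty C) : Prop where
  left_iff : ∀ M : C, X M ↔ ∀ N : C, Y N → ∀ n : ℕ, Subsingleton (Abelian.Ext M N n)
  right_iff : ∀ N : C, Y N ↔ ∀ M : C, X M → ∀ n : ℕ, Subsingleton (Abelian.Ext M N n)

/-- Complete Ext-orthogonal pairs: every object `M` has an exact sequence
`0 → Y₀ → X₀ → M → Y₁ → X₁ → 0` with `X₀, X₁ ∈ 𝒳` and `Y₀, Y₁ ∈ 𝒴`. -/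
structure IsCompleteExtOrthogonalPair [HasExt.{w} C] (X Y : ObjectProperty C) : Prop
    extends IsExtOrthogonalPair X Y where
  exists_exact : ∀ M : C, ∃ (Y₀ X₀ Y₁ X₁ : C)
    (a : Y₀ ⟶ X₀) (b : X₀ ⟶ M) (c : M ⟶ Y₁) (d : Y₁ ⟶ X₁)
    (hab : a ≫ b = 0) (hbc : b ≫ c = 0) (hcd : c ≫ d = 0),
    X X₀ ∧ X X₁ ∧ Y Y₀ ∧ Y Y₁ ∧
    Mono a ∧ (ShortComplex.mk a b hab).Exact ∧ (ShortComplex.mk b c hbc).Exact ∧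
      (ShortComplex.mk c d hcd).Exact ∧ Epi d

end Abelian

/-- A ring is (left) hereditary if all its left ideals are projective modules. -/
def IsHereditary (A : Type u) [Ring A] : Prop :=
  ∀ I : Ideal A, Module.Projective A I

end TorsionExt

namespace TorsionExt

open Abelian Limits

section Hereditary

/-! Heredity forces injective dimension at most one, so `Ext²` vanishes and `Ext¹` is right exact in
both variables. Hence `Ext¹(X, N) = 0` passes to subobjects of `X`, and the long exact sequence
kills all maps from `ker (Z ⟶ X)` to `N` once `Hom(Z, N) = 0`; dually for cokernels. This gives `𝒳 ⊆
α(𝒯)` and `𝒴 ⊆ β(ℱ)`. Conversely, for `M` in `α(𝒯)` or `β(ℱ)` the five-term sequence collapses to an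
isomorphism `X₀ ≅ M` or `M ≅ Y₁`. Uniqueness holds because `𝒳^{⊥₀}` consists of subobjects of
objects of `𝒴`. -/

/-- Over a hereditary ring, quotients of injective modules are injective. -/
theorem IsHereditary.injective_of_surjective {A : Type u} [Ring A] [Small.{v} A]
    (hA : IsHereditary A) {E Q : Type v} [AddCommGroup E] [Module A E] [AddCommGroup Q]
    [Module A Q] (hE : Module.Injective A E) (p : E →ₗ[A] Q) (hp : Function.Surjective p) :
    Module.Injective A Q := by
  refine Module.Baer.injective fun I g ↦ ?_
  -- Baer's criterion: lift `g` to `E` since `I` is projective, then extend to `A` since `E` is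
  -- injective.
  have := hA I
  obtain ⟨l, hl⟩ := Module.projective_lifting_property p g hp
  obtain ⟨l', hl'⟩ := Module.Baer.of_injective hE I l
  refine ⟨p ∘ₗ l', fun x hx ↦ ?_⟩
  rw [LinearMap.comp_apply, hl' x hx, ← LinearMap.comp_apply, hl]

/-- Over a hereditary ring, quotient objects of injective objects are injective. -/
theorem IsHereditary.injective_of_epi {A : Type u} [Ring A] [Small.{v} A]
    (hA : IsHereditary A) {E Q : ModuleCat.{v} A} (hE : Injective E) (p : E ⟶ Q) [Epi p] :
    Injective Q := by
  have : Injective (ModuleCat.of A E) := hE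
  have := hA.injective_of_surjective (Module.injective_module_of_injective_object A E) p.hom
    ((ModuleCat.epi_iff_surjective p).1 inferInstance)
  exact Module.injective_object_of_injective_module A Q

/-- Modules over a hereditary ring have injective dimension at most one. -/
theorem IsHereditary.hasInjectiveDimensionLT_two {A : Type u} [Ring A] [Small.{v} A]
    (hA : IsHereditary A) (N : ModuleCat.{v} A) : HasInjectiveDimensionLT N 2 := by
  have hinj : Injective (cokernel (Injective.ι N)) :=
    hA.injective_of_epi inferInstance (cokernel.π (Injective.ι N))
  have hS : (ShortComplex.mk (Injective.ι N) (cokernel.π (Injective.ι N)) (by simp)).ShortExact :=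
    { exact := ShortComplex.exact_cokernel _ }
  exact hS.hasInjectiveDimensionLT_X₁ 1
    (inferInstanceAs (HasInjectiveDimensionLT (cokernel (Injective.ι N)) 1))
    (inferInstanceAs (HasInjectiveDimensionLT (Injective.under N) 2))

end Hereditary

section

variable {C : Type u} [Category.{v} C] [Abelian C]

/-- Together with `shortExact_image_cokernel`, this splits `f` at its image, so that two long exact
sequences can be chained. -/
theorem shortExact_kernel_factorThruImage {Z X : C} (f : Z ⟶ X) :
    (ShortComplex.mk (kernel.ι f) (Abelian.factorThruImage f)
      (by simp [← cancel_mono (Abelian.image.ι f)])).ShortExact where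
  exact := by
    let φ : ShortComplex.mk (kernel.ι f) (Abelian.factorThruImage f)
          (by simp [← cancel_mono (Abelian.image.ι f)]) ⟶
        ShortComplex.mk (kernel.ι f) f (by simp) :=
      { τ₁ := 𝟙 _
        τ₂ := 𝟙 _
        τ₃ := Abelian.image.ι f }
    have : Epi φ.τ₁ := inferInstanceAs (Epi (𝟙 _))
    have : IsIso φ.τ₂ := inferInstanceAs (IsIso (𝟙 _))
    have : Mono φ.τ₃ := inferInstanceAs (Mono (Abelian.image.ι f))
    exact (ShortComplex.exact_iff_of_epi_of_isIso_of_mono φ).2 (ShortComplex.exact_kernel f)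

theorem shortExact_image_cokernel {Z X : C} (f : Z ⟶ X) :
    (ShortComplex.mk (Abelian.image.ι f) (cokernel.π f) (by simp)).ShortExact where
  exact := ShortComplex.exact_kernel (cokernel.π f)

section Ext

variable [HasExt.{w} C]

theorem eq_zero_of_subsingleton_ext_zero {M N : C} (h : Subsingleton (Ext M N 0)) (f : M ⟶ N) :
    f = 0 :=
  Ext.addEquiv₀.symm.injective (Subsingleton.elim _ _)

theorem subsingleton_ext_of_iso {M M' N N' : C} (e : M ≅ M') (e' : N ≅ N') {n : ℕ}
    (h : Subsingleton (Ext M N n)) : Subsingleton (Ext M' N' n) := by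
  refine subsingleton_of_forall_eq 0 fun x ↦ ?_
  have hx : ((Ext.mk₀ e.hom).comp x (zero_add n)).comp (Ext.mk₀ e'.inv) (add_zero n) = 0 :=
    Subsingleton.elim _ _
  have := congrArg (fun y ↦ ((Ext.mk₀ e.inv).comp y (zero_add n)).comp
    (Ext.mk₀ e'.hom) (add_zero n)) hx
  simpa using this

/-- If `Hom(Z, N) = 0`, `Ext¹(X, N) = 0` and `N` has injective dimension at most one, there are no
non-zero morphisms from the kernel of a morphism `Z ⟶ X` to `N`. -/
theorem eq_zero_of_kernel {Z X N : C} [HasInjectiveDimensionLT N 2] (f : Z ⟶ X)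
    (hZ : ∀ g : Z ⟶ N, g = 0) (hX : Subsingleton (Ext X N 1)) (g : kernel f ⟶ N) : g = 0 := by
  -- `Ext¹(X, N)` surjects onto `Ext¹(im f, N)`, as `Ext²(coker f, N) = 0`.
  have hI : ∀ x : Ext (Abelian.image f) N 1, x = 0 := fun x ↦ by
    obtain ⟨y, rfl⟩ := Ext.contravariant_sequence_exact₁ (shortExact_image_cokernel f) N x
      (n₁ := 2) rfl (Ext.eq_zero_of_hasInjectiveDimensionLT _ 2 le_rfl)
    rw [Subsingleton.elim y 0, Ext.comp_zero]
  obtain ⟨y, hy⟩ := Ext.contravariant_sequence_exact₁ (shortExact_kernel_factorThruImage f) N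
    (Ext.mk₀ g) (n₁ := 1) rfl (hI _)
  obtain ⟨k, rfl⟩ := Ext.addEquiv₀.symm.surjective y
  rw [hZ k, map_zero, Ext.comp_zero] at hy
  exact Ext.mk₀_eq_zero_iff _ |>.1 hy.symm

/-- If `Hom(M, Z) = 0`, `Ext¹(M, N) = 0` and all objects have injective dimension at most one,
there are no non-zero morphisms from `M` to the cokernel of a morphism `N ⟶ Z`. -/
theorem eq_zero_of_cokernel {N Z M : C} (f : N ⟶ Z) [HasInjectiveDimensionLT (kernel f) 2]
    (hZ : ∀ g : M ⟶ Z, g = 0) (hN : Subsingleton (Ext M N 1)) (g : M ⟶ cokernel f) : g = 0 := by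
  -- `Ext¹(M, N)` surjects onto `Ext¹(M, im f)`, as `Ext²(M, ker f) = 0`.
  have hI : ∀ x : Ext M (Abelian.image f) 1, x = 0 := fun x ↦ by
    obtain ⟨y, rfl⟩ := Ext.covariant_sequence_exact₃ M (shortExact_kernel_factorThruImage f) x
      (n₁ := 2) rfl (Ext.eq_zero_of_hasInjectiveDimensionLT _ 2 le_rfl)
    rw [Subsingleton.elim y 0, Ext.zero_comp]
  obtain ⟨y, hy⟩ := Ext.covariant_sequence_exact₃ M (shortExact_image_cokernel f)
    (Ext.mk₀ g) (n₁ := 1) rfl (hI _)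
  obtain ⟨k, rfl⟩ := Ext.addEquiv₀.symm.surjective y
  rw [hZ k, map_zero, Ext.zero_comp] at hy
  exact Ext.mk₀_eq_zero_iff _ |>.1 hy.symm

end Ext

section Orthogonal

variable {P : ObjectProperty C}

theorem rightOrthogonal_of_mono {M N : C} (i : M ⟶ N) [Mono i] (hN : P.rightOrthogonal N) :
    P.rightOrthogonal M := fun _ f hX ↦ by
  rw [← cancel_mono i, hN (f ≫ i) hX, zero_comp]

theorem leftOrthogonal_of_epi {M N : C} (p : M ⟶ N) [Epi p] (hM : P.leftOrthogonal M) :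
    P.leftOrthogonal N := fun _ f hY ↦ by
  rw [← cancel_epi p, hM (p ≫ f) hY, comp_zero]

theorem le_torsionClass : P ≤ torsionClass P := fun _ hM _ f hF ↦ hF f hM

end Orthogonal

namespace IsTorsionPair

variable {T F : ObjectProperty C} (h : IsTorsionPair T F)

include h

theorem right_eq : F = T.rightOrthogonal := by
  ext M
  refine ⟨fun hM X f hX ↦ h.hom_eq_zero f hX hM, fun hM ↦ ?_⟩
  obtain ⟨X, Y, i, p, zero, hX, hY, hS⟩ := h.exists_shortExact M
  have := h.right_iso
  have : Epi p := hS.epi_g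
  have : Mono p := hS.exact.mono_g (hM i hX)
  have := isIso_of_mono_of_epi p
  exact F.prop_of_iso (asIso p).symm hY

theorem left_eq : T = F.leftOrthogonal := by
  ext M
  refine ⟨fun hM X f hX ↦ h.hom_eq_zero f hM hX, fun hM ↦ ?_⟩
  obtain ⟨X, Y, i, p, zero, hX, hY, hS⟩ := h.exists_shortExact M
  have := h.left_iso
  have : Mono i := hS.mono_f
  have : Epi i := hS.exact.epi_f (hM p hY)
  have := isIso_of_mono_of_epi i
  exact T.prop_of_iso (asIso i) hX

end IsTorsionPair

theorem IsExtOrthogonalPair.hom_eq_zero [HasExt.{w} C] {X Y : ObjectProperty C}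
    (h : IsExtOrthogonalPair.{w} X Y) {M N : C} (hM : X M) (hN : Y N) (f : M ⟶ N) : f = 0 :=
  eq_zero_of_subsingleton_ext_zero ((h.left_iff M).1 hM N hN 0) f

namespace IsCompleteExtOrthogonalPair

variable [HasExt.{w} C] {X Y : ObjectProperty C} (h : IsCompleteExtOrthogonalPair.{w} X Y)

include h

theorem left_of_iso {M M' : C} (e : M ≅ M') (hM : X M) : X M' :=
  (h.left_iff M').2 fun N hN n ↦
    subsingleton_ext_of_iso e (Iso.refl N) ((h.left_iff M).1 hM N hN n)

theorem right_of_iso {N N' : C} (e : N ≅ N') (hN : Y N) : Y N' :=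
  (h.right_iff N').2 fun M hM n ↦
    subsingleton_ext_of_iso (Iso.refl M) e ((h.right_iff N).1 hN M hM n)

theorem right_le_rightOrthogonal : Y ≤ X.rightOrthogonal := fun _ hN _ f hM ↦
  h.hom_eq_zero hM hN f

/-- Objects of `𝒳^{⊥₀}` embed into objects of `𝒴`. -/
theorem exists_mono_of_rightOrthogonal {M : C} (hM : X.rightOrthogonal M) :
    ∃ (N : C) (i : M ⟶ N), Mono i ∧ Y N := by
  obtain ⟨Y₀, X₀, Y₁, X₁, a, b, c, d, hab, hbc, hcd, hX₀, hX₁, hY₀, hY₁, _, -, hbc', -, -⟩ :=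
    h.exists_exact M
  exact ⟨Y₁, c, hbc'.mono_g (hM b hX₀), hY₁⟩

/-- The image of `X₀ ⟶ M` is a quotient of an object of `𝒳`, and `M` modulo this image embeds in
`Y₁`. -/
theorem isTorsionPair : IsTorsionPair (torsionClass X) X.rightOrthogonal where
  left_iso := by unfold torsionClass; infer_instance
  right_iso := inferInstance
  hom_eq_zero _ _ f hT hF := hT f hF
  exists_shortExact M := by
    obtain ⟨Y₀, X₀, Y₁, X₁, a, b, c, d, hab, hbc, hcd, hX₀, hX₁, hY₀, hY₁, _, -, hbc', -, -⟩ :=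
      h.exists_exact M
    refine ⟨Abelian.image b, cokernel b, Abelian.image.ι b, cokernel.π b, by simp,
      leftOrthogonal_of_epi (Abelian.factorThruImage b) (le_torsionClass _ hX₀), ?_,
      shortExact_image_cokernel b⟩
    have : Mono (cokernel.desc b c hbc) := hbc'.mono_cokernelDesc
    exact rightOrthogonal_of_mono (cokernel.desc b c hbc) (h.right_le_rightOrthogonal _ hY₁)

theorem left_eq_alpha (hC : ∀ N : C, HasInjectiveDimensionLT N 2) :
    X = alpha (torsionClass X) := by
  ext M
  constructor
  · refine fun hM ↦ ⟨le_torsionClass _ hM, fun Z f hZ F g hF ↦ ?_⟩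
    -- `Ext¹(M, -)` is only known to vanish on `𝒴`, so `F` is replaced by an object of `𝒴`
    -- containing it.
    obtain ⟨N, i, _, hN⟩ := h.exists_mono_of_rightOrthogonal hF
    have := hC N
    rw [← cancel_mono i, zero_comp]
    exact eq_zero_of_kernel f (fun k ↦ hZ k (h.right_le_rightOrthogonal _ hN))
      ((h.left_iff M).1 hM N hN 1) _
  · rintro ⟨hM, hM'⟩
    obtain ⟨Y₀, X₀, Y₁, X₁, a, b, c, d, hab, hbc, hcd, hX₀, hX₁, hY₀, hY₁, _, hab', hbc', -, -⟩ :=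
      h.exists_exact M
    have : Epi b := hbc'.epi_f (hM c (h.right_le_rightOrthogonal _ hY₁))
    -- `ker b` is torsion as `M` lies in `α`, yet its inclusion factors through the torsion-free
    -- `Y₀`.
    have hk : kernel.ι b = 0 := by
      rw [← hab'.lift_f (kernel.ι b) (kernel.condition b)]
      have : hab'.lift (kernel.ι b) (kernel.condition b) = 0 :=
        hM' b (le_torsionClass _ hX₀) _ (h.right_le_rightOrthogonal _ hY₀)
      rw [this, zero_comp]
    have : Mono b := Preadditive.mono_of_kernel_zero hk
    have := isIso_of_mono_of_epi b
    exact h.left_of_iso (asIso b) hX₀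

theorem right_eq_beta (hC : ∀ N : C, HasInjectiveDimensionLT N 2) :
    Y = beta X.rightOrthogonal := by
  ext N
  constructor
  · refine fun hN ↦ ⟨h.right_le_rightOrthogonal _ hN, fun Z f hZ M g hM ↦ ?_⟩
    have := hC (kernel f)
    exact eq_zero_of_cokernel f (fun k ↦ hZ k hM) ((h.right_iff N).1 hN M hM 1) g
  · rintro ⟨hN, hN'⟩
    obtain ⟨Y₀, X₀, Y₁, X₁, a, b, c, d, hab, hbc, hcd, hX₀, hX₁, hY₀, hY₁, _, -, hbc', hcd', _⟩ :=
      h.exists_exact N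
    have : Mono c := hbc'.mono_g (hN b hX₀)
    -- `coker c` is torsion-free as `N` lies in `β`, yet the projection onto it factors through
    -- `X₁`.
    have hk : cokernel.π c = 0 := by
      rw [← hcd'.g_desc (cokernel.π c) (cokernel.condition c)]
      have : hcd'.desc (cokernel.π c) (cokernel.condition c) = 0 :=
        hN' c (h.right_le_rightOrthogonal _ hY₁) _ hX₁
      rw [this, comp_zero]
    have : Epi c := Preadditive.epi_of_cokernel_zero hk
    have := isIso_of_mono_of_epi c
    exact h.right_of_iso (asIso c).symm hY₁

/-- A torsion pair `(𝒯, ℱ)` with `𝒳 ⊆ 𝒯` and `𝒴 ⊆ ℱ` is generated by `𝒳`. -/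
theorem eq_of_isTorsionPair {T F : ObjectProperty C} (hTF : IsTorsionPair T F) (hXT : X ≤ T)
    (hYF : Y ≤ F) : T = torsionClass X ∧ F = X.rightOrthogonal := by
  have hF : F = X.rightOrthogonal := by
    ext M
    refine ⟨fun hM Z f hZ ↦ hTF.hom_eq_zero f (hXT _ hZ) hM, fun hM ↦ ?_⟩
    obtain ⟨N, i, _, hN⟩ := h.exists_mono_of_rightOrthogonal hM
    have hN' := hYF _ hN
    -- As a right orthogonal, `F` is closed under subobjects.
    rw [hTF.right_eq] at hN' ⊢
    exact rightOrthogonal_of_mono i hN'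
  exact ⟨by rw [hTF.left_eq, hF, torsionClass], hF⟩

end IsCompleteExtOrthogonalPair

end

end TorsionExt

theorem mainTheorem10 {A : Type u} [Ring A] [Small.{v} A] (hA : TorsionExt.IsHereditary A)
    (X Y : ObjectProperty (ModuleCat.{v} A))
    (hXY : TorsionExt.IsCompleteExtOrthogonalPair.{v} X Y) :
    (∃! P : ObjectProperty (ModuleCat.{v} A) × ObjectProperty (ModuleCat.{v} A),
      TorsionExt.IsTorsionPair P.1 P.2 ∧
        X = TorsionExt.alpha P.1 ∧ Y = TorsionExt.beta P.2) ∧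
    TorsionExt.IsTorsionPair (TorsionExt.torsionClass X) X.rightOrthogonal ∧
    X = TorsionExt.alpha (TorsionExt.torsionClass X) ∧
    Y = TorsionExt.beta X.rightOrthogonal := by
  have hC := hA.hasInjectiveDimensionLT_two (A := A)
  have hα := hXY.left_eq_alpha hC
  have hβ := hXY.right_eq_beta hC
  refine ⟨⟨(TorsionExt.torsionClass X, X.rightOrthogonal), ⟨hXY.isTorsionPair, hα, hβ⟩, ?_⟩,
    hXY.isTorsionPair, hα, hβ⟩
  rintro ⟨T, F⟩ ⟨hTF, hX, hY⟩
  have hXT : X ≤ T := by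
    rw [hX]
    exact inf_le_left
  have hYF : Y ≤ F := by
    rw [hY]
    exact inf_le_left
  obtain ⟨h₁, h₂⟩ := hXY.eq_of_isTorsionPair hTF hXT hYF
  exact Prod.ext h₁ h₂
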